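/- Let $p>0$. Consider two half-lines on which a non-negative local variance is linear: $v(X)=v_0+v_1X$ with $v_1<0$ on $(-\infty,X_l]$, and $v(X)=w_0+w_1X$ with $w_1>0$ on $[X_r,\infty)$. On a half-line where $v=v_0+v_1X$, consider the equation $$(b_2+a_2X)\,B''(X)+(b_0+a_0X)\,B(X)=p\,f(X),$$ with $b_2=-v_0/2$, $a_2=-v_1/2$, $b_0=p+v_0/8$, $a_0=v_1/8$ (and $w_0,w_1$ in place of $v_0,v_1$ on the right half-line). Let $k=\tfrac12$ on the left half-line and $k=-\tfrac12$ on the right one, and put $$\mu=-\frac{b_2}{a_2},\qquad a=\frac{b_2k^2+b_0}{2a_2k}>0,\qquad z=2k(\mu-X),$$ $$y_1=e^{kX}zU(a+1,2,z),\qquad y_2=e^{kX}zM(a+1,2,z),\qquad W=y_1y_2'-y_2y_1',$$ where $M$ and $U$ are Kummer's functions and primes denote $X$-derivatives. The particular solution is $p\,I_{12}$ with $$I_{12}(X)=y_2(X)\int\frac{y_1f}{(b_2+a_2X)W}\,dX-y_1(X)\int\frac{y_2f}{(b_2+a_2X)W}\,dX .$$ Here the first primitive is the one that vanishes at infinity,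 $\int_{-\infty}^X$ on the left half-line and $\int_{+\infty}^X$ on the right one, and the second primitive is arbitrary. (1) For the first time step, where $f(X)=e^{-X/2}\mathbf 1_{X>0}+e^{X/2}\mathbf 1_{X\le0}$, one has $I_{12}(X)\to0$ as $X\to-\infty$ (left half-line) and as $X\to+\infty$ (right half-line), and in both cases $I_{12}(X)=O(1/z^2)$. (2) The same limits hold for every source $f=B_{j-1}(\cdot,\tau_{j-1})$ of a later time step, and more generally for every continuous $f:\mathbb R\to\mathbb R$ with $f(X)\to0$ as $X\to\pm\infty$. For every such $f$ the integrals $\int_{\mp\infty}^X$ in the definition of $I_{12}$ converge absolutely and $I_{12}(X)\to0$ as $X\to\mp\infty$. -/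

import Mathlib

open Real Set Filter Topology MeasureTheory Asymptotics

noncomputable section

namespace LocalVariance

/-- Kummer's function of the first kind, `M(a,b,z) = ∑ (a)ₙ / (b)ₙ * zⁿ / n!`. -/
def kummerM (a b z : ℝ) : ℝ :=
  ∑' n : ℕ, (ascPochhammer ℝ n).eval a / (ascPochhammer ℝ n).eval b * z ^ n / (n.factorial : ℝ)

/-- Kummer's function of the second kind for `a > 0` and `z > 0` (the only range in which it is
used), `U(a,b,z) = Γ(a)⁻¹ ∫_0^∞ e^{-z t} t^{a-1} (1+t)^{b-a-1} dt`. -/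
def kummerU (a b z : ℝ) : ℝ :=
  (Real.Gamma a)⁻¹ *
    ∫ t in Ioi (0 : ℝ), Real.exp (-(z * t)) * t ^ (a - 1) * (1 + t) ^ (b - a - 1)

/-- The data of the Laplace-transformed pricing equation
`(b₂ + a₂ X) B'' + (b₀ + a₀ X) B = p f(X)` on an interval where the local variance is
`v₀ + v₁ X`: the Laplace parameter `p`, the coefficients `v₀`, `v₁`, and the exponent `k`
(`k = 1/2` where `v₁ < 0` and `k = -1/2` where `v₁ > 0`). -/
structure Piece where
  p : ℝ
  v₀ : ℝ
  v₁ : ℝ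
  k : ℝ

namespace Piece

def b₂ (P : Piece) : ℝ := -P.v₀ / 2

def a₂ (P : Piece) : ℝ := -P.v₁ / 2

def b₀ (P : Piece) : ℝ := P.p + P.v₀ / 8

def μ (P : Piece) : ℝ := -P.b₂ / P.a₂

def a (P : Piece) : ℝ := (P.b₂ * P.k ^ 2 + P.b₀) / (2 * P.a₂ * P.k)

/-- `z = 2k(μ - X)`: this is `μ - X` for `k = 1/2` and `X - μ` for `k = -1/2`. -/
def z (P : Piece) (X : ℝ) : ℝ := 2 * P.k * (P.μ - X)

/-- The homogeneous solution `e^{kX} z U(a+1,2,z)`. -/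
def y₁ (P : Piece) (X : ℝ) : ℝ :=
  Real.exp (P.k * X) * P.z X * kummerU (P.a + 1) 2 (P.z X)

/-- The homogeneous solution `e^{kX} z M(a+1,2,z)`. -/
def y₂ (P : Piece) (X : ℝ) : ℝ :=
  Real.exp (P.k * X) * P.z X * kummerM (P.a + 1) 2 (P.z X)

/-- The Wronskian `y₁ y₂' - y₂ y₁'`, derivatives with respect to `X`. -/
def W (P : Piece) (X : ℝ) : ℝ := P.y₁ X * deriv P.y₂ X - P.y₂ X * deriv P.y₁ X

/-- The integrand `y₁ f / ((b₂ + a₂ X) W)`. -/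
def integrand₁ (P : Piece) (f : ℝ → ℝ) (X : ℝ) : ℝ :=
  P.y₁ X * f X / ((P.b₂ + P.a₂ * X) * P.W X)

/-- The integrand `y₂ f / ((b₂ + a₂ X) W)`. -/
def integrand₂ (P : Piece) (f : ℝ → ℝ) (X : ℝ) : ℝ :=
  P.y₂ X * f X / ((P.b₂ + P.a₂ * X) * P.W X)

/-- The particular-solution term on an interval `(-∞, X₁]`. The primitive multiplying `y₂` is
`∫_{-∞}^X`; the one multiplying `y₁` is the arbitrary primitive `c + ∫_ξ^X`. -/
def I₁₂Left (P : Piece) (f : ℝ → ℝ) (ξ c X : ℝ) : ℝ :=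
  P.y₂ X * (∫ x in Iic X, P.integrand₁ f x) - P.y₁ X * (c + ∫ x in ξ..X, P.integrand₂ f x)

/-- The particular-solution term on an interval `[X_n, ∞)`. The primitive multiplying `y₂` is
`∫_{+∞}^X = -∫_X^{+∞}`; the one multiplying `y₁` is the arbitrary primitive `c + ∫_ξ^X`. -/
def I₁₂Right (P : Piece) (f : ℝ → ℝ) (ξ c X : ℝ) : ℝ :=
  P.y₂ X * (-∫ x in Ioi X, P.integrand₁ f x) - P.y₁ X * (c + ∫ x in ξ..X, P.integrand₂ f x)

end Piece

/-- The first-step payoff `e^{-X/2} 1_{X > 0} + e^{X/2} 1_{X ≤ 0}`. -/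
def payoff (X : ℝ) : ℝ := if 0 < X then Real.exp (-X / 2) else Real.exp (X / 2)

end LocalVariance

end

/-! In the variable `z` both half-lines become the same problem at `z → +∞`. There `y₁` and `y₂` are
constant multiples of `decaying` and `growing`, whose Wronskian is constant, so `(b₂ + a₂ X) W` is a
constant times `z`. Hence `I₁₂` combines `growing z * ∫_z^∞ decaying * g / s` and `decaying z * (c +
K * ∫ growing * g / s)`, where `g` is the source read in `z`.

Everything rests on the sizes `decaying ≲ e^{-z/2} z^{-a}` and `growing ≲ e^{z/2} z^a`. The first
comes from the Laplace integral for `U`, which also bounds `U` below by a multiple of `z^{-(a+1)}`.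
The second needs no asymptotic expansion of `M`: in the constant `z² e^{-z} (U M' - M U')` both
summands are nonnegative, so the lower bound on `U` bounds `M'` above, and `M` is at most a multiple
of `M'` (`exists_kummerM_le`).

In both terms the powers `z^{±a}` and the exponentials then compensate. For bounded `g` the factor
`1 / s` leaves `O(1/z)` (`tendsto_particular`). For the payoff, `g` itself decays like `e^{-s/2}`,
and both terms are exponentially small up to a factor `z` (`particular_isBigO`). -/

noncomputable section

namespace LocalVariance

/-! ### Power series and Kummer's function `M` -/

/-- The exponential generating function `∑ dₙ zⁿ / n!`. -/
def egf (d : ℕ → ℝ) (z : ℝ) : ℝ := ∑' n : ℕ, d n * z ^ n / (n.factorial : ℝ)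

lemma summable_egf {d : ℕ → ℝ} {C K : ℝ} (hd : ∀ n, |d n| ≤ C * K ^ n) (z : ℝ) :
    Summable fun n : ℕ => d n * z ^ n / (n.factorial : ℝ) := by
  refine Summable.of_norm_bounded ((Real.summable_pow_div_factorial (K * |z|)).mul_left C) ?_
  intro n
  rw [Real.norm_eq_abs, abs_div, abs_mul, abs_pow, Nat.abs_cast, mul_pow, ← mul_div_assoc,
    ← mul_assoc]
  gcongr
  exact hd n

lemma shift_bound {d : ℕ → ℝ} {C K : ℝ} (hd : ∀ n, |d n| ≤ C * K ^ n) (n : ℕ) :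
    |d (n + 1)| ≤ (C * K) * K ^ n := by
  calc _ ≤ _ := hd (n + 1)
    _ = _ := by ring

lemma egf_deriv_term (d : ℕ → ℝ) (z : ℝ) (n : ℕ) :
    d (n + 1) * (((n + 1 : ℕ) : ℝ) * z ^ (n + 1 - 1)) / ((n + 1).factorial : ℝ)
      = d (n + 1) * z ^ n / (n.factorial : ℝ) := by
  rw [Nat.factorial_succ, Nat.add_sub_cancel]
  have : (n.factorial : ℝ) ≠ 0 := by positivity
  push_cast
  field_simp

/-- Differentiation shifts the coefficients. It is done term by term on the ball of radius `|z| +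
1`, where `u` is a summable majorant of the derivatives. -/
lemma hasDerivAt_egf {d : ℕ → ℝ} {C K : ℝ} (hK : 0 ≤ K) (hd : ∀ n, |d n| ≤ C * K ^ n) (z : ℝ) :
    HasDerivAt (egf d) (egf (fun n => d (n + 1)) z) z := by
  set R := |z| + 1
  have hz : z ∈ Metric.ball (0 : ℝ) R := by simp [R]
  have hC : 0 ≤ C := by simpa using (abs_nonneg _).trans (hd 0)
  have hR : 0 ≤ R := by positivity
  let u : ℕ → ℝ := fun n => C * K ^ n * (n * R ^ (n - 1)) / (n.factorial : ℝ)
  have hu : Summable u := by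
    rw [← summable_nat_add_iff 1]
    have := summable_egf (d := fun n => C * K ^ (n + 1)) (C := C * K) (K := K)
      (fun n => by rw [abs_of_nonneg (by positivity)]; apply le_of_eq; ring) R
    refine this.congr fun n => ?_
    exact (egf_deriv_term (fun n => C * K ^ n) R n).symm
  have key := hasDerivAt_tsum_of_isPreconnected
    (g := fun (n : ℕ) (y : ℝ) => d n * y ^ n / (n.factorial : ℝ))
    (g' := fun (n : ℕ) (y : ℝ) => d n * (n * y ^ (n - 1)) / (n.factorial : ℝ)) (t := Metric.ball 0 R)
    (y₀ := z) (y := z) hu Metric.isOpen_ball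
    (convex_ball _ _).isPreconnected
    (fun n y _ => ((hasDerivAt_pow n y).const_mul (d n)).div_const _)
    (fun n y hy => by
      have hy' : |y| ≤ R := by simpa using (mem_ball_zero_iff.mp hy).le
      rw [Real.norm_eq_abs, abs_div, abs_mul, abs_mul, abs_pow, Nat.abs_cast, Nat.abs_cast]
      simp only [u]
      gcongr
      exact hd n)
    hz (summable_egf hd z) hz
  have hs : Summable fun n : ℕ => d n * (n * z ^ (n - 1)) / (n.factorial : ℝ) := by
    rw [← summable_nat_add_iff 1]
    exact (summable_egf (shift_bound hd) z).congr fun n => (egf_deriv_term d z n).symm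
  have he : egf (fun n => d (n + 1)) z
      = ∑' n : ℕ, d n * (n * z ^ (n - 1)) / (n.factorial : ℝ) := by
    rw [hs.tsum_eq_zero_add]
    simp only [egf_deriv_term]
    simp [egf]
  rw [he]
  exact key

lemma mul_egf {d : ℕ → ℝ} {C K : ℝ} (hd : ∀ n, |d n| ≤ C * K ^ n) (z : ℝ) :
    z * egf d z = ∑' n : ℕ, (n : ℝ) * d (n - 1) * z ^ n / (n.factorial : ℝ) := by
  have h : ∀ n : ℕ, ((n + 1 : ℕ) : ℝ) * d (n + 1 - 1) * z ^ (n + 1) / ((n + 1).factorial : ℝ)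
      = z * (d n * z ^ n / (n.factorial : ℝ)) := by
    intro n
    rw [Nat.factorial_succ, Nat.add_sub_cancel]
    have : (n.factorial : ℝ) ≠ 0 := by positivity
    push_cast
    field_simp
    ring
  have hs : Summable fun n : ℕ => (n : ℝ) * d (n - 1) * z ^ n / (n.factorial : ℝ) := by
    rw [← summable_nat_add_iff 1]
    exact ((summable_egf hd z).mul_left z).congr fun n => (h n).symm
  rw [hs.tsum_eq_zero_add, egf, ← tsum_mul_left]
  simp only [h]
  simp

/-- The coefficients `(α)ₙ / (b)ₙ` of Kummer's function. -/
def kummerCoeff (α b : ℝ) (n : ℕ) : ℝ :=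
  (ascPochhammer ℝ n).eval α / (ascPochhammer ℝ n).eval b

lemma kummerM_eq_egf (α b z : ℝ) : kummerM α b z = egf (kummerCoeff α b) z := rfl

lemma kummerCoeff_zero (α b : ℝ) : kummerCoeff α b 0 = 1 := by simp [kummerCoeff]

lemma kummerCoeff_succ (α b : ℝ) (n : ℕ) :
    kummerCoeff α b (n + 1) = kummerCoeff α b n * ((α + n) / (b + n)) := by
  simp [kummerCoeff, ascPochhammer_succ_eval, mul_div_mul_comm]

lemma kummerCoeff_pos {α b : ℝ} (hα : 0 < α) (hb : 0 < b) (n : ℕ) : 0 < kummerCoeff α b n :=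
  div_pos (ascPochhammer_pos n α hα) (ascPochhammer_pos n b hb)

/-- Successive coefficients have ratio `(α + n) / (b + n) ≤ 1 + α / b`; geometric growth is all that
the lemmas on `egf` require. -/
lemma kummerCoeff_bound {α b : ℝ} (hα : 0 < α) (hb : 0 < b) (n : ℕ) :
    |kummerCoeff α b n| ≤ 1 * (1 + α / b) ^ n := by
  rw [abs_of_pos (kummerCoeff_pos hα hb n), one_mul]
  induction n with
  | zero => simp [kummerCoeff_zero]
  | succ n ih =>
    rw [kummerCoeff_succ, pow_succ]
    have h : (α + n) / (b + n) ≤ 1 + α / b := by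
      rw [div_le_iff₀ (by positivity)]
      have : (1 + α / b) * (b + n) = α + n + (b + α * n / b) := by field_simp; ring
      rw [this]
      have : 0 ≤ b + α * n / b := by positivity
      linarith
    have := kummerCoeff_pos hα hb n
    gcongr

/-- The derivative of Kummer's function `M(α,b,·)`. -/
def kummerM' (α b z : ℝ) : ℝ := egf (fun n => kummerCoeff α b (n + 1)) z

/-- The second derivative of Kummer's function `M(α,b,·)`. -/
def kummerM'' (α b z : ℝ) : ℝ := egf (fun n => kummerCoeff α b (n + 2)) z

lemma hasDerivAt_kummerM {α b : ℝ} (hα : 0 < α) (hb : 0 < b) (z : ℝ) :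
    HasDerivAt (kummerM α b) (kummerM' α b z) z :=
  hasDerivAt_egf (by positivity) (kummerCoeff_bound hα hb) z

lemma hasDerivAt_kummerM' {α b : ℝ} (hα : 0 < α) (hb : 0 < b) (z : ℝ) :
    HasDerivAt (kummerM' α b) (kummerM'' α b z) z :=
  hasDerivAt_egf (by positivity) (shift_bound (kummerCoeff_bound hα hb)) z

/-- Kummer's differential equation for `M(α,b,·)`. -/
lemma kummerM_ode {α b : ℝ} (hα : 0 < α) (hb : 0 < b) (z : ℝ) :
    z * kummerM'' α b z + (b - z) * kummerM' α b z - α * kummerM α b z = 0 := by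
  have h0 := kummerCoeff_bound hα hb
  have h1 := shift_bound h0
  have h2 := shift_bound h1
  have e2 := mul_egf h2 z
  have e1 := mul_egf h1 z
  have hb' : ∀ n : ℕ, b + n ≠ 0 := fun n => by positivity
  -- At `n = 0` the truncated `n - 1` gives a wrong index, but the factor `n` kills that term.
  have aux : ∀ n : ℕ, (n : ℝ) * kummerCoeff α b (n - 1 + 1 + 1) = n * kummerCoeff α b (n + 1) := by
    rintro (_ | n) <;> simp
  have aux' : ∀ n : ℕ, (n : ℝ) * kummerCoeff α b (n - 1 + 1) = n * kummerCoeff α b n := by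
    rintro (_ | n) <;> simp
  simp only [aux, aux'] at e1 e2
  have s : Summable fun n : ℕ => (n : ℝ) * kummerCoeff α b n * z ^ n / (n.factorial : ℝ) := by
    rw [← summable_nat_add_iff 1]
    refine ((summable_egf h1 z).mul_left z).congr fun n => ?_
    rw [Nat.factorial_succ]
    have : (n.factorial : ℝ) ≠ 0 := by positivity
    push_cast
    field_simp
    ring
  have t1 : b * kummerM' α b z
      = ∑' n : ℕ, b * (kummerCoeff α b (n + 1) * z ^ n / (n.factorial : ℝ)) := by
    rw [tsum_mul_left]; rfl
  have t0 : α * kummerM α b z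
      = ∑' n : ℕ, α * (kummerCoeff α b n * z ^ n / (n.factorial : ℝ)) := by
    rw [tsum_mul_left]; rfl
  have hsum : (∑' n : ℕ, (n : ℝ) * kummerCoeff α b n * z ^ n / (n.factorial : ℝ))
      + α * kummerM α b z - b * kummerM' α b z
      = ∑' n : ℕ, (n : ℝ) * kummerCoeff α b (n + 1) * z ^ n / (n.factorial : ℝ) := by
    rw [t0, t1, ← s.tsum_add ((summable_egf h0 z).mul_left α),
      ← (s.add ((summable_egf h0 z).mul_left α)).tsum_sub ((summable_egf h1 z).mul_left b)]
    refine tsum_congr fun n => ?_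
    rw [kummerCoeff_succ]
    have := hb' n
    field_simp
    ring
  have e2' : z * kummerM'' α b z
      = ∑' n : ℕ, (n : ℝ) * kummerCoeff α b (n + 1) * z ^ n / (n.factorial : ℝ) := e2
  have e1' : z * kummerM' α b z
      = ∑' n : ℕ, (n : ℝ) * kummerCoeff α b n * z ^ n / (n.factorial : ℝ) := e1
  linarith

lemma kummerM_nonneg {α b z : ℝ} (hα : 0 < α) (hb : 0 < b) (hz : 0 ≤ z) : 0 ≤ kummerM α b z :=
  tsum_nonneg fun n => by have := kummerCoeff_pos hα hb n; unfold kummerCoeff at this; positivity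

/-- `M` is bounded by a multiple of its derivative. -/
lemma kummerM_le_deriv {α b z : ℝ} (hα : 0 < α) (hb : 0 < b) (hz : 0 ≤ z) :
    kummerM α b z ≤ (1 + b / α) * kummerM' α b z := by
  rw [kummerM_eq_egf, kummerM', egf, egf, ← tsum_mul_left]
  refine (summable_egf (kummerCoeff_bound hα hb) z).tsum_le_tsum (fun n => ?_)
    ((summable_egf (shift_bound (kummerCoeff_bound hα hb)) z).mul_left _)
  have hc := kummerCoeff_pos hα hb n
  have h : 1 ≤ (1 + b / α) * ((α + n) / (b + n)) := by
    rw [← mul_div_assoc, le_div_iff₀ (by positivity)]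
    have : (1 + b / α) * (α + n) = b + n + (α + b * n / α) := by field_simp; ring
    rw [this]
    have : 0 ≤ α + b * n / α := by positivity
    linarith
  rw [kummerCoeff_succ]
  calc _ = 1 * (kummerCoeff α b n * z ^ n / (n.factorial : ℝ)) := (one_mul _).symm
    _ ≤ ((1 + b / α) * ((α + n) / (b + n))) * (kummerCoeff α b n * z ^ n / (n.factorial : ℝ)) := by
      gcongr
    _ = _ := by ring

/-! ### Laplace integrals and Kummer's function `U` -/

/-- The Laplace transform `∫_0^∞ e^{-zt} φ(t) dt`. -/
def lapl (φ : ℝ → ℝ) (z : ℝ) : ℝ := ∫ t in Ioi (0 : ℝ), Real.exp (-(z * t)) * φ t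

/-- The Laplace integral of `φ` converges absolutely on `(0, ∞)`. -/
def HasLapl (φ : ℝ → ℝ) : Prop :=
  ∀ z > 0, IntegrableOn (fun t => Real.exp (-(z * t)) * φ t) (Ioi (0 : ℝ))

lemma HasLapl.aestronglyMeasurable {φ : ℝ → ℝ} (h : HasLapl φ) :
    AEStronglyMeasurable φ (volume.restrict (Ioi 0)) := by
  have h1 := (h 1 one_pos).aestronglyMeasurable
  have h2 : AEStronglyMeasurable (fun t : ℝ => Real.exp (1 * t)) (volume.restrict (Ioi 0)) := by
    fun_prop
  refine (h2.mul h1).congr (Eventually.of_forall fun t => ?_)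
  simp only [Pi.mul_apply]
  rw [← mul_assoc, ← Real.exp_add]
  simp

/-- Of the decay rate `z / 2`, half absorbs the factor `t` and `z / 4` remains. This dominates the
`x`-derivative of the Laplace integrand uniformly for `x > z / 2`. -/
lemma mul_exp_neg_le {z x t : ℝ} (hz : 0 < z) (ht : 0 < t) (hx : z / 2 < x) :
    t * Real.exp (-(x * t)) ≤ 4 / z * Real.exp (-(z / 4 * t)) := by
  have h1 : z / 4 * t ≤ Real.exp (z / 4 * t) := by
    have := Real.add_one_le_exp (z / 4 * t); linarith
  have h2 : t ≤ 4 / z * Real.exp (z / 4 * t) := by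
    calc t = 4 / z * (z / 4 * t) := by field_simp
      _ ≤ _ := by gcongr
  calc t * Real.exp (-(x * t)) ≤ 4 / z * Real.exp (z / 4 * t) * Real.exp (-(z / 2 * t)) := by
        gcongr
    _ = 4 / z * Real.exp (-(z / 4 * t)) := by
        rw [mul_assoc, ← Real.exp_add]; ring_nf

lemma HasLapl.deriv_aux {φ : ℝ → ℝ} (h : HasLapl φ) {z : ℝ} (hz : 0 < z) :
    IntegrableOn (fun t => -(Real.exp (-(z * t)) * (t * φ t))) (Ioi (0 : ℝ)) ∧
      HasDerivAt (lapl φ) (∫ t in Ioi (0 : ℝ), -(Real.exp (-(z * t)) * (t * φ t))) z := by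
  have hm := h.aestronglyMeasurable
  refine hasDerivAt_integral_of_dominated_loc_of_deriv_le (s := Ioi (z / 2))
    (F := fun x t => Real.exp (-(x * t)) * φ t)
    (F' := fun x t => -(Real.exp (-(x * t)) * (t * φ t)))
    (bound := fun t => 4 / z * ‖Real.exp (-(z / 4 * t)) * φ t‖)
    (Ioi_mem_nhds (by linarith)) (Eventually.of_forall fun x => ?_) (h z hz) ?_ ?_ ?_ ?_
  · exact AEStronglyMeasurable.mul (by fun_prop) hm
  · exact (AEStronglyMeasurable.mul (by fun_prop) (AEStronglyMeasurable.mul (by fun_prop) hm)).neg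
  · refine (ae_restrict_mem measurableSet_Ioi).mono fun t ht x hx => ?_
    have ht : 0 < t := ht
    rw [norm_neg, norm_mul, norm_mul, norm_mul, Real.norm_of_nonneg ht.le,
      Real.norm_of_nonneg (Real.exp_pos _).le, Real.norm_of_nonneg (Real.exp_pos _).le]
    have := mul_exp_neg_le hz ht hx
    calc _ = t * Real.exp (-(x * t)) * ‖φ t‖ := by ring
      _ ≤ 4 / z * Real.exp (-(z / 4 * t)) * ‖φ t‖ := by gcongr
      _ = _ := by ring
  · exact (h (z / 4) (by linarith)).norm.const_mul _
  · refine Eventually.of_forall fun t x _ => ?_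
    have : HasDerivAt (fun x => Real.exp (-(x * t))) (Real.exp (-(x * t)) * -(1 * t)) x :=
      ((hasDerivAt_id x).mul_const t).neg.exp
    exact (this.mul_const (φ t)).congr_deriv (by ring)

lemma HasLapl.mul_id {φ : ℝ → ℝ} (h : HasLapl φ) : HasLapl fun t => t * φ t := fun z hz => by
  simpa using (h.deriv_aux hz).1.neg

lemma HasLapl.hasDerivAt {φ : ℝ → ℝ} (h : HasLapl φ) {z : ℝ} (hz : 0 < z) :
    HasDerivAt (lapl φ) (-lapl (fun t => t * φ t) z) z := by
  have := (h.deriv_aux hz).2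
  rwa [integral_neg] at this

/-- The density `t^a (1+t)^{-a}` in the integral for `U(a+1,2,·)`. -/
def kummerDensity (a t : ℝ) : ℝ := t ^ a * (1 + t) ^ (-a)

lemma kummerU_eq (a z : ℝ) :
    kummerU (a + 1) 2 z = (Real.Gamma (a + 1))⁻¹ * lapl (kummerDensity a) z := by
  simp only [kummerU, lapl, kummerDensity]
  congr 2
  ext t
  rw [mul_assoc]
  congr 3 <;> ring

lemma kummerDensity_nonneg (a : ℝ) {t : ℝ} (ht : 0 ≤ t) : 0 ≤ kummerDensity a t := by
  unfold kummerDensity; positivity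

lemma kummerDensity_le_rpow {a t : ℝ} (ha : 0 < a) (ht : 0 ≤ t) : kummerDensity a t ≤ t ^ a := by
  unfold kummerDensity
  have : (1 + t) ^ (-a) ≤ 1 := Real.rpow_le_one_of_one_le_of_nonpos (by linarith) (by linarith)
  have h := Real.rpow_nonneg ht a
  nlinarith

lemma integrableOn_exp_mul_rpow {a z : ℝ} (ha : 0 < a) (hz : 0 < z) :
    IntegrableOn (fun t => Real.exp (-(z * t)) * t ^ a) (Ioi (0 : ℝ)) := by
  refine (integrableOn_rpow_mul_exp_neg_mul_rpow (p := 1) (s := a) (b := z) (by linarith) one_pos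
    hz).congr_fun (fun t _ => ?_) measurableSet_Ioi
  simp only [Real.rpow_one]
  ring_nf

lemma continuousOn_kummerDensity {a : ℝ} (ha : 0 < a) :
    ContinuousOn (kummerDensity a) (Ici 0) := by
  refine ContinuousOn.mul (Real.continuous_rpow_const ha.le).continuousOn ?_
  refine ContinuousOn.rpow_const (by fun_prop) fun t ht => Or.inl ?_
  have : (0 : ℝ) ≤ t := ht
  positivity

lemma hasLapl_kummerDensity {a : ℝ} (ha : 0 < a) : HasLapl (kummerDensity a) := fun z hz => by
  refine (integrableOn_exp_mul_rpow ha hz).mono' ?_ ?_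
  · refine AEStronglyMeasurable.mul (by fun_prop) ?_
    exact ((continuousOn_kummerDensity ha).mono Ioi_subset_Ici_self).aestronglyMeasurable
      measurableSet_Ioi
  · refine (ae_restrict_mem measurableSet_Ioi).mono fun t ht => ?_
    have ht : 0 < t := ht
    rw [Real.norm_of_nonneg (mul_nonneg (Real.exp_pos _).le (kummerDensity_nonneg a ht.le))]
    gcongr
    exact kummerDensity_le_rpow ha ht.le

lemma lapl_kummerDensity_le {a z : ℝ} (ha : 0 < a) (hz : 0 < z) :
    lapl (kummerDensity a) z ≤ Real.Gamma (a + 1) * z ^ (-(a + 1)) := by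
  have h := Real.integral_rpow_mul_exp_neg_mul_Ioi (a := a + 1) (by linarith) hz
  calc lapl (kummerDensity a) z ≤ ∫ t in Ioi (0 : ℝ), Real.exp (-(z * t)) * t ^ a := by
        refine setIntegral_mono_on (hasLapl_kummerDensity ha z hz)
          (integrableOn_exp_mul_rpow ha hz) measurableSet_Ioi fun t ht => ?_
        have ht : 0 < t := ht
        gcongr
        exact kummerDensity_le_rpow ha ht.le
    _ = ∫ t in Ioi (0 : ℝ), t ^ (a + 1 - 1) * Real.exp (-(z * t)) := by
        simp only [add_sub_cancel_right, mul_comm]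
    _ = _ := by
        rw [h, one_div, Real.inv_rpow hz.le, Real.rpow_neg hz.le, mul_comm]

/-- The part `t ≤ 1 / z` of the integral already has the right order: there `e^{-zt} ≥ e^{-1}`, and
`t ≤ 1` gives `(1 + t)^{-a} ≥ 2^{-a}`. -/
lemma le_lapl_kummerDensity {a z : ℝ} (ha : 0 < a) (hz : 1 ≤ z) :
    2 ^ (-a) * (Real.exp (-1) / (a + 1)) * z ^ (-(a + 1)) ≤ lapl (kummerDensity a) z := by
  have hz0 : 0 < z := by linarith
  have hiz : 0 ≤ 1 / z := by positivity
  have hint := hasLapl_kummerDensity ha z hz0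
  have hsub : Ioc 0 (1 / z) ⊆ Ioi (0 : ℝ) := fun t ht => ht.1
  have hp : ∫ t in Ioc 0 (1 / z), t ^ a = z ^ (-(a + 1)) / (a + 1) := by
    rw [← intervalIntegral.integral_of_le hiz, integral_rpow (Or.inl (by linarith)),
      Real.zero_rpow (by linarith), sub_zero, one_div, Real.inv_rpow hz0.le, Real.rpow_neg hz0.le]
  have hpi : IntegrableOn (fun t : ℝ => t ^ a) (Ioc 0 (1 / z)) := by
    rw [← intervalIntegrable_iff_integrableOn_Ioc_of_le hiz]
    exact intervalIntegral.intervalIntegrable_rpow' (by linarith)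
  calc 2 ^ (-a) * (Real.exp (-1) / (a + 1)) * z ^ (-(a + 1))
      = ∫ t in Ioc 0 (1 / z), 2 ^ (-a) * Real.exp (-1) * t ^ a := by
        rw [integral_const_mul, hp]; ring
    _ ≤ ∫ t in Ioc 0 (1 / z), Real.exp (-(z * t)) * kummerDensity a t := by
        refine setIntegral_mono_on (hpi.const_mul _) (hint.mono_set hsub) measurableSet_Ioc
          fun t ht => ?_
        have ht0 : 0 < t := ht.1
        have hzt : z * t ≤ 1 := by
          have := ht.2
          rw [le_div_iff₀ hz0] at this
          linarith
        have ht1 : t ≤ 1 := by nlinarith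
        have h1 : Real.exp (-1) ≤ Real.exp (-(z * t)) := Real.exp_le_exp.mpr (by linarith)
        have h2 : (2 : ℝ) ^ (-a) ≤ (1 + t) ^ (-a) :=
          Real.rpow_le_rpow_of_nonpos (by linarith) (by linarith) (by linarith)
        have h3 : 0 ≤ t ^ a := by positivity
        calc 2 ^ (-a) * Real.exp (-1) * t ^ a ≤ (1 + t) ^ (-a) * Real.exp (-(z * t)) * t ^ a := by
              gcongr
          _ = _ := by unfold kummerDensity; ring
    _ ≤ _ := setIntegral_mono_set hint
        ((ae_restrict_mem measurableSet_Ioi).mono fun t ht =>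
          mul_nonneg (Real.exp_pos _).le (kummerDensity_nonneg a (le_of_lt ht)))
        hsub.eventuallyLE

/-- Kummer's differential equation for the Laplace integral of `t^a (1+t)^{-a}`. -/
lemma lapl_kummerDensity_ode {a z : ℝ} (ha : 0 < a) (hz : 0 < z) :
    z * lapl (fun t => t * (t * kummerDensity a t)) z
      - (2 - z) * lapl (fun t => t * kummerDensity a t) z
      - (a + 1) * lapl (kummerDensity a) z = 0 := by
  have h0 := hasLapl_kummerDensity ha
  have h1 := h0.mul_id
  have h2 := h1.mul_id
  have i0 := (h0 z hz).const_mul (a + 1)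
  have i1 := (h1 z hz).const_mul (2 - z)
  have i2 := (h2 z hz).const_mul z
  -- The combination in the equation is the integral of `F'`, because the density `φ` satisfies `t
  -- (1 + t) φ' = a φ`. Both boundary values of `F` vanish.
  let F : ℝ → ℝ := fun t => -(Real.exp (-(z * t)) * (t * (1 + t) * kummerDensity a t))
  have hF0 : F 0 = 0 := by simp [F]
  have hcont : ContinuousWithinAt F (Ici 0) 0 := by
    have : ContinuousOn F (Ici 0) := by
      refine ContinuousOn.neg (ContinuousOn.mul (by fun_prop) (ContinuousOn.mul (by fun_prop) ?_))
      exact continuousOn_kummerDensity ha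
    exact this 0 self_mem_Ici
  have hderiv : ∀ t ∈ Ioi (0 : ℝ), HasDerivAt F
      (z * (Real.exp (-(z * t)) * (t * (t * kummerDensity a t)))
        - (2 - z) * (Real.exp (-(z * t)) * (t * kummerDensity a t))
        - (a + 1) * (Real.exp (-(z * t)) * kummerDensity a t)) t := by
    intro t ht
    have ht : 0 < t := ht
    have ht1 : 0 < 1 + t := by linarith
    have e1 : HasDerivAt (fun t => Real.exp (-(z * t))) (Real.exp (-(z * t)) * -(z * 1)) t :=
      ((hasDerivAt_id t).const_mul z).neg.exp
    have e2 : HasDerivAt (fun t : ℝ => t * (1 + t)) (1 * (1 + t) + t * 1) t :=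
      (hasDerivAt_id t).mul ((hasDerivAt_id t).const_add 1)
    have e3 : HasDerivAt (kummerDensity a)
        (a * t ^ (a - 1) * (1 + t) ^ (-a) + t ^ a * (1 * (-a) * (1 + t) ^ (-a - 1))) t :=
      (Real.hasDerivAt_rpow_const (Or.inl ht.ne')).mul
        (((hasDerivAt_id t).const_add 1).rpow_const (Or.inl ht1.ne'))
    refine (e1.mul (e2.mul e3)).neg.congr_deriv ?_
    rw [Real.rpow_sub_one ht.ne', Real.rpow_sub_one ht1.ne']
    simp only [Pi.mul_apply, kummerDensity]
    field_simp
    ring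
  have hlim : Tendsto F atTop (𝓝 0) := by
    have hb : Tendsto (fun t => (z⁻¹ * ((z * t) ^ 1 * Real.exp (-(z * t)))
        + z⁻¹ ^ 2 * ((z * t) ^ 2 * Real.exp (-(z * t))))) atTop (𝓝 0) := by
      have hzt : Tendsto (fun t : ℝ => z * t) atTop atTop := tendsto_id.const_mul_atTop hz
      have q1 := ((Real.tendsto_pow_mul_exp_neg_atTop_nhds_zero 1).comp hzt).const_mul z⁻¹
      have q2 := ((Real.tendsto_pow_mul_exp_neg_atTop_nhds_zero 2).comp hzt).const_mul (z⁻¹ ^ 2)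
      simpa using q1.add q2
    refine squeeze_zero_norm' ?_ hb
    filter_upwards [eventually_gt_atTop 0] with t ht
    have hk := kummerDensity_nonneg a ht.le
    have hk1 : kummerDensity a t ≤ 1 := by
      unfold kummerDensity
      rw [Real.rpow_neg (by linarith), ← div_eq_mul_inv, ← Real.div_rpow ht.le (by linarith)]
      refine Real.rpow_le_one (by positivity) ?_ ha.le
      rw [div_le_one (by linarith)]
      linarith
    simp only [F]
    rw [norm_neg, Real.norm_of_nonneg (by positivity)]
    calc _ ≤ Real.exp (-(z * t)) * (t * (1 + t) * 1) := by gcongr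
      _ = _ := by field_simp
  have key := integral_Ioi_of_hasDerivAt_of_tendsto hcont hderiv ((i2.sub i1).sub i0) hlim
  have hs := (integral_sub (i2.sub i1) i0).trans
    (congrArg (· - ∫ t in Ioi (0 : ℝ), (a + 1) * (Real.exp (-(z * t)) * kummerDensity a t))
      (integral_sub i2 i1))
  simp only [integral_const_mul] at hs
  rw [hF0, sub_zero] at key
  exact hs.symm.trans key

lemma lapl_nonneg {φ : ℝ → ℝ} (h : ∀ t, 0 ≤ t → 0 ≤ φ t) (z : ℝ) : 0 ≤ lapl φ z :=
  setIntegral_nonneg measurableSet_Ioi fun t ht =>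
    mul_nonneg (Real.exp_pos _).le (h t (le_of_lt ht))

/-- The derivative of `U(a+1,2,·)`. -/
def kummerU' (a z : ℝ) : ℝ :=
  (Real.Gamma (a + 1))⁻¹ * -lapl (fun t => t * kummerDensity a t) z

/-- The second derivative of `U(a+1,2,·)`. -/
def kummerU'' (a z : ℝ) : ℝ :=
  (Real.Gamma (a + 1))⁻¹ * lapl (fun t => t * (t * kummerDensity a t)) z

lemma hasDerivAt_kummerU {a z : ℝ} (ha : 0 < a) (hz : 0 < z) :
    HasDerivAt (kummerU (a + 1) 2) (kummerU' a z) z := by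
  rw [show kummerU (a + 1) 2 = _ from funext (kummerU_eq a)]
  exact ((hasLapl_kummerDensity ha).hasDerivAt hz).const_mul _

lemma hasDerivAt_kummerU' {a z : ℝ} (ha : 0 < a) (hz : 0 < z) :
    HasDerivAt (kummerU' a) (kummerU'' a z) z := by
  have := ((hasLapl_kummerDensity ha).mul_id.hasDerivAt hz).neg.const_mul
    (Real.Gamma (a + 1))⁻¹
  rwa [neg_neg] at this

/-- Kummer's differential equation for `U(a+1,2,·)`. -/
lemma kummerU_ode {a z : ℝ} (ha : 0 < a) (hz : 0 < z) :
    z * kummerU'' a z + (2 - z) * kummerU' a z - (a + 1) * kummerU (a + 1) 2 z = 0 := by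
  rw [kummerU_eq, kummerU', kummerU'']
  linear_combination (Real.Gamma (a + 1))⁻¹ * lapl_kummerDensity_ode ha hz

/-! ### Wronskian and growth of the two solutions -/

/-- The normalized Wronskian of `U(a+1,2,·)` and `M(a+1,2,·)`. -/
def kummerWronskian (a z : ℝ) : ℝ :=
  z ^ 2 * Real.exp (-z) *
    (kummerU (a + 1) 2 z * kummerM' (a + 1) 2 z - kummerM (a + 1) 2 z * kummerU' a z)

/-- Abel's identity: for `z w'' + (2 - z) w' = (a + 1) w` the Wronskian is a multiple of `z^{-2}
e^z`, which the prefactor cancels. -/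
lemma kummerWronskian_const {a z : ℝ} (ha : 0 < a) (hz : 0 < z) :
    kummerWronskian a z = kummerWronskian a 1 := by
  have hα : 0 < a + 1 := by linarith
  have hd : ∀ x ∈ Ioi (0 : ℝ), HasDerivAt (kummerWronskian a) 0 x := by
    intro x hx
    have hx : 0 < x := hx
    have hU := hasDerivAt_kummerU ha hx
    have hU' := hasDerivAt_kummerU' ha hx
    have hM := hasDerivAt_kummerM hα two_pos x
    have hM' := hasDerivAt_kummerM' hα two_pos x
    have e := (((hasDerivAt_pow 2 x).mul (hasDerivAt_neg x).exp).mul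
      ((hU.mul hM').sub (hM.mul hU')))
    refine e.congr_deriv ?_
    simp only [Pi.mul_apply, Pi.sub_apply]
    push_cast
    linear_combination (x * Real.exp (-x) * kummerU (a + 1) 2 x) * kummerM_ode hα two_pos x
      - (x * Real.exp (-x) * kummerM (a + 1) 2 x) * kummerU_ode ha hx
  exact isOpen_Ioi.is_const_of_deriv_eq_zero isPreconnected_Ioi
    (fun x hx => (hd x hx).differentiableAt.differentiableWithinAt)
    (fun x hx => (hd x hx).deriv) hz (by simp)

lemma kummerU_nonneg {a : ℝ} (ha : 0 < a) (z : ℝ) : 0 ≤ kummerU (a + 1) 2 z := by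
  rw [kummerU_eq]
  have := Real.Gamma_pos_of_pos (show 0 < a + 1 by linarith)
  exact mul_nonneg (by positivity) (lapl_nonneg (fun t => kummerDensity_nonneg a) z)

lemma kummerU'_nonpos {a : ℝ} (ha : 0 < a) (z : ℝ) : kummerU' a z ≤ 0 := by
  have := Real.Gamma_pos_of_pos (show 0 < a + 1 by linarith)
  have h := lapl_nonneg (φ := fun t => t * kummerDensity a t)
    (fun t ht => mul_nonneg ht (kummerDensity_nonneg a ht)) z
  unfold kummerU'
  rw [mul_neg]
  exact neg_nonpos.mpr (by positivity)

lemma kummerU_le {a z : ℝ} (ha : 0 < a) (hz : 0 < z) :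
    kummerU (a + 1) 2 z ≤ z ^ (-(a + 1)) := by
  have hG := Real.Gamma_pos_of_pos (show 0 < a + 1 by linarith)
  rw [kummerU_eq, inv_mul_le_iff₀ hG]
  exact lapl_kummerDensity_le ha hz

lemma exists_le_kummerU {a : ℝ} (ha : 0 < a) :
    ∃ c > 0, ∀ z ≥ 1, c * z ^ (-(a + 1)) ≤ kummerU (a + 1) 2 z := by
  have hG := Real.Gamma_pos_of_pos (show 0 < a + 1 by linarith)
  refine ⟨(Real.Gamma (a + 1))⁻¹ * (2 ^ (-a) * (Real.exp (-1) / (a + 1))), by positivity,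
    fun z hz => ?_⟩
  rw [kummerU_eq, mul_assoc]
  gcongr
  exact le_lapl_kummerDensity ha hz

/-- The growth of `M` follows from the constancy of the Wronskian and the decay of `U`. -/
lemma exists_kummerM_le {a : ℝ} (ha : 0 < a) :
    ∃ C, ∀ z ≥ 1, kummerM (a + 1) 2 z ≤ C * (Real.exp z * z ^ (a - 1)) := by
  have hα : 0 < a + 1 := by linarith
  obtain ⟨c, hc, hU⟩ := exists_le_kummerU ha
  refine ⟨(1 + 2 / (a + 1)) * (kummerWronskian a 1 / c), fun z hz => ?_⟩
  have hz0 : 0 < z := by linarith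
  have hM := kummerM_nonneg hα two_pos hz0.le
  have hMM' := kummerM_le_deriv hα two_pos hz0.le
  have hM' : 0 ≤ kummerM' (a + 1) 2 z := by
    by_contra h
    have : (1 + 2 / (a + 1)) * kummerM' (a + 1) 2 z < 0 :=
      mul_neg_of_pos_of_neg (by positivity) (not_le.mp h)
    linarith
  have hW := kummerWronskian_const ha hz0
  have hp : z ^ (a - 1) * (z ^ 2 * z ^ (-(a + 1))) = 1 := by
    rw [← Real.rpow_natCast z 2, ← Real.rpow_add hz0, ← Real.rpow_add hz0]
    convert Real.rpow_zero z using 2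
    push_cast
    ring
  -- Since `U' ≤ 0`, the summand `-M U'` of the Wronskian can be dropped, which leaves an upper
  -- bound on `U M'`.
  have hMU : 0 ≤ z ^ 2 * Real.exp (-z) * (kummerM (a + 1) 2 z * -kummerU' a z) := by
    have := kummerU'_nonpos ha z
    exact mul_nonneg (by positivity) (mul_nonneg hM (by linarith))
  have h1 : z ^ 2 * Real.exp (-z) * (c * z ^ (-(a + 1)) * kummerM' (a + 1) 2 z)
      ≤ kummerWronskian a 1 := by
    calc _ ≤ z ^ 2 * Real.exp (-z) * (kummerU (a + 1) 2 z * kummerM' (a + 1) 2 z) := by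
          gcongr
          exact hU z hz
      _ ≤ kummerWronskian a z := by unfold kummerWronskian; linarith
      _ = _ := hW
  have hee : Real.exp z * Real.exp (-z) = 1 := by rw [← Real.exp_add]; simp
  have h2 : kummerM' (a + 1) 2 z
      ≤ kummerWronskian a 1 / c * (Real.exp z * z ^ (a - 1)) := by
    calc kummerM' (a + 1) 2 z
        = (Real.exp z * Real.exp (-z)) * (z ^ (a - 1) * (z ^ 2 * z ^ (-(a + 1))))
            * kummerM' (a + 1) 2 z := by rw [hee, hp]; ring
      _ = (z ^ 2 * Real.exp (-z) * (c * z ^ (-(a + 1)) * kummerM' (a + 1) 2 z)) / c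
            * (Real.exp z * z ^ (a - 1)) := by field_simp
      _ ≤ _ := by gcongr
  calc _ ≤ _ := hMM'
    _ ≤ (1 + 2 / (a + 1)) * (kummerWronskian a 1 / c * (Real.exp z * z ^ (a - 1))) := by gcongr
    _ = _ := by ring

/-- The decaying solution in the variable `z`. -/
def decaying (a z : ℝ) : ℝ := Real.exp (-z / 2) * z * kummerU (a + 1) 2 z

/-- The growing solution in the variable `z`. -/
def growing (a z : ℝ) : ℝ := Real.exp (-z / 2) * z * kummerM (a + 1) 2 z

lemma hasDerivAt_exp_mul (z : ℝ) :
    HasDerivAt (fun z : ℝ => Real.exp (-z / 2) * z)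
      (Real.exp (-z / 2) * (-1 / 2) * z + Real.exp (-z / 2) * 1) z :=
  ((hasDerivAt_neg z).div_const 2).exp.mul (hasDerivAt_id z)

lemma hasDerivAt_decaying {a z : ℝ} (ha : 0 < a) (hz : 0 < z) :
    HasDerivAt (decaying a) ((Real.exp (-z / 2) * (-1 / 2) * z + Real.exp (-z / 2) * 1)
      * kummerU (a + 1) 2 z + Real.exp (-z / 2) * z * kummerU' a z) z :=
  (hasDerivAt_exp_mul z).mul (hasDerivAt_kummerU ha hz)

lemma hasDerivAt_growing {a : ℝ} (ha : 0 < a) (z : ℝ) :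
    HasDerivAt (growing a) ((Real.exp (-z / 2) * (-1 / 2) * z + Real.exp (-z / 2) * 1)
      * kummerM (a + 1) 2 z + Real.exp (-z / 2) * z * kummerM' (a + 1) 2 z) z :=
  (hasDerivAt_exp_mul z).mul (hasDerivAt_kummerM (by linarith) two_pos z)

/-- The derivative of the common prefactor `e^{-z/2} z` cancels, and its square is the weight `z²
e^{-z}` in `kummerWronskian`. -/
lemma wronskian_decaying_growing {a z : ℝ} (ha : 0 < a) (hz : 0 < z) :
    decaying a z * deriv (growing a) z - growing a z * deriv (decaying a) z
      = kummerWronskian a 1 := by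
  rw [(hasDerivAt_decaying ha hz).deriv, (hasDerivAt_growing ha z).deriv,
    ← kummerWronskian_const ha hz, kummerWronskian, decaying, growing]
  have : Real.exp (-z) = Real.exp (-z / 2) * Real.exp (-z / 2) := by
    rw [← Real.exp_add]; ring_nf
  rw [this]
  ring

lemma continuousOn_decaying {a : ℝ} (ha : 0 < a) : ContinuousOn (decaying a) (Ioi 0) :=
  fun _ hz => (hasDerivAt_decaying ha hz).continuousAt.continuousWithinAt

lemma continuous_growing {a : ℝ} (ha : 0 < a) : Continuous (growing a) :=
  continuous_iff_continuousAt.mpr fun z => (hasDerivAt_growing ha z).continuousAt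

lemma abs_decaying_le {a z : ℝ} (ha : 0 < a) (hz : 0 < z) :
    |decaying a z| ≤ Real.exp (-z / 2) * z ^ (-a) := by
  have hU := kummerU_nonneg ha z
  unfold decaying
  rw [abs_of_nonneg (by positivity), mul_assoc]
  gcongr
  calc z * kummerU (a + 1) 2 z ≤ z * z ^ (-(a + 1)) := by
        gcongr
        exact kummerU_le ha hz
    _ = z ^ (-a) := by
        rw [mul_comm, ← Real.rpow_add_one hz.ne']
        ring_nf

lemma exists_abs_growing_le {a : ℝ} (ha : 0 < a) :
    ∃ C ≥ 0, ∀ z ≥ 1, |growing a z| ≤ C * (Real.exp (z / 2) * z ^ a) := by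
  obtain ⟨C, hC⟩ := exists_kummerM_le ha
  refine ⟨|C|, abs_nonneg _, fun z hz => ?_⟩
  have hz0 : 0 < z := by linarith
  have hM := kummerM_nonneg (show 0 < a + 1 by linarith) two_pos hz0.le
  unfold growing
  rw [abs_of_nonneg (by positivity)]
  calc _ ≤ Real.exp (-z / 2) * z * (|C| * (Real.exp z * z ^ (a - 1))) := by
        gcongr
        exact (hC z hz).trans (by gcongr; exact le_abs_self C)
    _ = |C| * ((Real.exp (-z / 2) * Real.exp z) * (z ^ (a - 1) * z)) := by ring
    _ = _ := by
        rw [← Real.exp_add, ← Real.rpow_add_one hz0.ne']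
        ring_nf

lemma integrableOn_exp_neg_half (z : ℝ) : IntegrableOn (fun s => Real.exp (-s / 2)) (Ioi z) := by
  have := integrableOn_exp_mul_Ioi (a := -1 / 2) (by norm_num) z
  refine this.congr_fun (fun s _ => ?_) measurableSet_Ioi
  ring_nf

lemma integral_exp_neg_half (z : ℝ) :
    ∫ s in Ioi z, Real.exp (-s / 2) = 2 * Real.exp (-z / 2) := by
  have := integral_exp_mul_Ioi (a := -1 / 2) (by norm_num) z
  calc _ = ∫ s in Ioi z, Real.exp (-1 / 2 * s) := by congr 1; ext s; ring_nf
    _ = _ := this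
    _ = _ := by ring_nf

/-! ### Estimates of the particular solution in the variable `z` -/

section Core

variable {a : ℝ} {g : ℝ → ℝ}

/-- The decreasing factor `s^{-a} / s` is frozen at `s = z`, so only an exponential remains to be
integrated. -/
lemma abs_decaying_integrand_le (ha : 0 < a) {G z s : ℝ} (hz : 0 < z) (hs : z < s)
    (hG : |g s| ≤ G) :
    |decaying a s * g s / s| ≤ G * (z ^ (-a) / z) * Real.exp (-s / 2) := by
  have hs0 : 0 < s := hz.trans hs
  rw [abs_div, abs_mul, abs_of_pos hs0]
  have h2 : s ^ (-a) ≤ z ^ (-a) := Real.rpow_le_rpow_of_nonpos hz hs.le (by linarith)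
  have h1 : |decaying a s| ≤ Real.exp (-s / 2) * z ^ (-a) :=
    (abs_decaying_le ha hs0).trans (by gcongr)
  have hG0 : 0 ≤ G := (abs_nonneg _).trans hG
  calc |decaying a s| * |g s| / s ≤ Real.exp (-s / 2) * z ^ (-a) * G / z := by gcongr
    _ = _ := by ring

lemma continuousOn_decaying_integrand (ha : 0 < a) (hg : Continuous g) :
    ContinuousOn (fun s => decaying a s * g s / s) (Ioi 0) :=
  ((continuousOn_decaying ha).mul hg.continuousOn).div continuousOn_id fun _ hs => ne_of_gt hs

lemma continuousOn_growing_integrand (ha : 0 < a) (hg : Continuous g) :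
    ContinuousOn (fun s => growing a s * g s / s) (Ioi 0) :=
  ((continuous_growing ha).mul hg).continuousOn.div continuousOn_id fun _ hs => ne_of_gt hs

lemma integrableOn_decaying (ha : 0 < a) (hg : Continuous g) {G z : ℝ} (hz : 0 < z)
    (hG : ∀ s > z, |g s| ≤ G) : IntegrableOn (fun s => decaying a s * g s / s) (Ioi z) := by
  refine ((integrableOn_exp_neg_half z).const_mul (G * (z ^ (-a) / z))).mono' ?_ ?_
  · exact ((continuousOn_decaying_integrand ha hg).mono
      (Ioi_subset_Ioi hz.le)).aestronglyMeasurable measurableSet_Ioi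
  · exact (ae_restrict_mem measurableSet_Ioi).mono fun s hs =>
      abs_decaying_integrand_le ha hz hs (hG s hs)

lemma intervalIntegrable_growing (ha : 0 < a) (hg : Continuous g) {x y : ℝ} (hx : 0 < x)
    (hy : 0 < y) : IntervalIntegrable (fun s => growing a s * g s / s) volume x y :=
  ((continuousOn_growing_integrand ha hg).mono fun _ hs =>
    (lt_min hx hy).trans_le hs.1).intervalIntegrable

/-- `C` is chosen before `g`, `G` and `z`, so `G` may be a bound on the tail `s > z` that depends on
`z`; for the payoff it is of order `e^{-z/2}`. -/
lemma exists_growing_mul_integral_le (ha : 0 < a) :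
    ∃ C ≥ 0, ∀ (g : ℝ → ℝ) (G z : ℝ), 1 ≤ z → (∀ s > z, |g s| ≤ G) →
      |growing a z * ∫ s in Ioi z, decaying a s * g s / s| ≤ C * G / z := by
  obtain ⟨C, hC0, hC⟩ := exists_abs_growing_le ha
  refine ⟨2 * C, by positivity, fun g G z hz hG => ?_⟩
  have hz0 : 0 < z := by linarith
  have hG0 : 0 ≤ G := (abs_nonneg _).trans (hG (z + 1) (by linarith))
  have hI : |∫ s in Ioi z, decaying a s * g s / s|
      ≤ G * (z ^ (-a) / z) * (2 * Real.exp (-z / 2)) := by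
    rw [← integral_exp_neg_half, ← integral_const_mul, ← Real.norm_eq_abs]
    exact norm_integral_le_of_norm_le ((integrableOn_exp_neg_half z).const_mul _)
      ((ae_restrict_mem measurableSet_Ioi).mono fun s hs =>
        abs_decaying_integrand_le ha hz0 hs (hG s hs))
  have hp : z ^ a * z ^ (-a) = 1 := by rw [← Real.rpow_add hz0]; simp
  have he : Real.exp (z / 2) * Real.exp (-z / 2) = 1 := by
    rw [← Real.exp_add, ← add_div]; simp
  rw [abs_mul]
  calc _ ≤ C * (Real.exp (z / 2) * z ^ a) * (G * (z ^ (-a) / z) * (2 * Real.exp (-z / 2))) := by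
        gcongr
        exact hC z hz
    _ = (Real.exp (z / 2) * Real.exp (-z / 2)) * (z ^ a * z ^ (-a)) * (2 * C * G / z) := by ring
    _ = _ := by rw [hp, he]; ring

/-- The increasing factor `s^a ≤ z^a` leaves the integral and cancels the `z^{-a}` of `decaying`.
The majorant `b` is later `G / s` for bounded sources and `G e^{-s/2}` for the payoff. -/
lemma exists_decaying_mul_integral_le (ha : 0 < a) (hg : Continuous g) {b : ℝ → ℝ}
    (hb : ContinuousOn b (Ici 1)) (hgb : ∀ s ≥ 1, |g s| / s ≤ b s) (c K : ℝ) {z₀ : ℝ}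
    (hz₀ : 0 < z₀) :
    ∃ D E : ℝ, ∀ z ≥ 1,
      |decaying a z * (c + K * ∫ s in z₀..z, growing a s * g s / s)|
        ≤ Real.exp (-z / 2) * (D + E * ∫ s in (1 : ℝ)..z, Real.exp (s / 2) * b s) := by
  obtain ⟨C, hC0, hC⟩ := exists_abs_growing_le ha
  -- The base point moves to `1`, where the bound on `growing` begins; the arbitrary constant and
  -- the piece from `z₀` to `1` go into `c'`.
  set c' := c + K * ∫ s in z₀..1, growing a s * g s / s with hc'
  refine ⟨|c'|, |K| * C, fun z hz => ?_⟩
  have hz0 : 0 < z := by linarith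
  have hbi : IntervalIntegrable (fun s => Real.exp (s / 2) * b s) volume 1 z := by
    refine ContinuousOn.intervalIntegrable (ContinuousOn.mul (by fun_prop) (hb.mono ?_))
    rw [uIcc_of_le hz]
    exact Icc_subset_Ici_self
  have hsplit : c + K * ∫ s in z₀..z, growing a s * g s / s
      = c' + K * ∫ s in (1 : ℝ)..z, growing a s * g s / s := by
    rw [← intervalIntegral.integral_add_adjacent_intervals
      (intervalIntegrable_growing ha hg hz₀ one_pos)
      (intervalIntegrable_growing ha hg one_pos hz0), hc']
    ring
  have hI : |∫ s in (1 : ℝ)..z, growing a s * g s / s|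
      ≤ (C * z ^ a) * ∫ s in (1 : ℝ)..z, Real.exp (s / 2) * b s := by
    rw [← intervalIntegral.integral_const_mul, ← Real.norm_eq_abs]
    refine intervalIntegral.norm_integral_le_of_norm_le hz (Eventually.of_forall fun s hs => ?_)
      (hbi.const_mul _)
    have hs1 : 1 ≤ s := hs.1.le
    have hs0 : 0 < s := by linarith
    have h3 := hgb s hs1
    have h4 : 0 ≤ |g s| / s := by positivity
    rw [Real.norm_eq_abs, abs_div, abs_mul, abs_of_pos hs0, mul_div_assoc]
    calc |growing a s| * (|g s| / s) ≤ C * (Real.exp (s / 2) * z ^ a) * b s := by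
          gcongr
          refine (hC s hs1).trans ?_
          gcongr
          exact hs.2
      _ = _ := by ring
  have hz1 : z ^ (-a) ≤ 1 := Real.rpow_le_one_of_one_le_of_nonpos hz (by linarith)
  have hp : z ^ (-a) * z ^ a = 1 := by rw [← Real.rpow_add hz0]; simp
  rw [hsplit, abs_mul]
  calc _ ≤ Real.exp (-z / 2) * z ^ (-a) *
        (|c'| + |K| * ((C * z ^ a) * ∫ s in (1 : ℝ)..z, Real.exp (s / 2) * b s)) := by
        gcongr
        · exact abs_decaying_le ha hz0
        · refine (abs_add_le _ _).trans ?_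
          rw [abs_mul]
          gcongr
    _ = Real.exp (-z / 2) * (z ^ (-a) * |c'| + (z ^ (-a) * z ^ a) *
        (|K| * C * ∫ s in (1 : ℝ)..z, Real.exp (s / 2) * b s)) := by ring
    _ ≤ _ := by
        rw [hp, one_mul]
        gcongr
        exact mul_le_of_le_one_left (abs_nonneg _) hz1

lemma tendsto_pow_mul_exp_neg_half (n : ℕ) :
    Tendsto (fun z : ℝ => z ^ n * Real.exp (-z / 2)) atTop (𝓝 0) := by
  have h := ((Real.tendsto_pow_mul_exp_neg_atTop_nhds_zero n).comp
    (tendsto_id.atTop_div_const (two_pos : (0 : ℝ) < 2))).const_mul (2 ^ n)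
  rw [mul_zero] at h
  refine h.congr fun z => ?_
  simp only [Function.comp_apply, id_eq, div_pow, neg_div]
  field_simp

lemma exp_neg_half_isBigO (n : ℕ) :
    (fun z : ℝ => z ^ n * Real.exp (-z / 2)) =O[atTop] fun z : ℝ => 1 / z ^ 2 := by
  refine IsBigO.of_bound 1 ?_
  have h := (tendsto_pow_mul_exp_neg_half (n + 2)).eventually (eventually_le_nhds one_pos)
  filter_upwards [h, eventually_gt_atTop 0] with z hz hz0
  rw [Real.norm_of_nonneg (by positivity), Real.norm_of_nonneg (by positivity), one_mul,
    le_div_iff₀ (by positivity)]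
  calc _ = z ^ (n + 2) * Real.exp (-z / 2) := by ring
    _ ≤ 1 := hz

/-- The right side `P` has derivative at least the integrand. For `4 e^{s/2} / s` alone this holds
when `s ≥ 4`; on `[1, 4]` the deficit `e^{s/2} (4 - s) / s²` is at most `3 e²`, the slope of the
linear term. -/
lemma integral_exp_half_div_le {z : ℝ} (hz : 1 ≤ z) :
    ∫ s in (1 : ℝ)..z, Real.exp (s / 2) * s⁻¹
      ≤ 4 * Real.exp (z / 2) / z + 3 * Real.exp 2 * z := by
  let P : ℝ → ℝ := fun s => 4 * Real.exp (s / 2) / s + 3 * Real.exp 2 * s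
  have hP : ∀ s ≥ (1 : ℝ), HasDerivAt P
      ((4 * (Real.exp (s / 2) * (1 / 2)) * s - 4 * Real.exp (s / 2) * 1) / s ^ 2
        + 3 * Real.exp 2 * 1) s := fun s hs => by
    have hs0 : s ≠ 0 := by positivity
    exact ((((hasDerivAt_id s).div_const 2).exp.const_mul 4).div (hasDerivAt_id s) hs0).add
      ((hasDerivAt_id s).const_mul _)
  have hP1 : 0 ≤ P 1 := by simp only [P]; positivity
  refine (intervalIntegral.integral_le_sub_of_hasDeriv_right_of_le hz
    (fun s hs => (hP s hs.1).continuousAt.continuousWithinAt)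
    (fun s hs => (hP s hs.1.le).hasDerivWithinAt) ?_ ?_).trans (sub_le_self (P z) hP1)
  · refine ContinuousOn.integrableOn_Icc (ContinuousOn.mul (by fun_prop) ?_)
    exact continuousOn_id.inv₀ fun s hs => (zero_lt_one.trans_le hs.1).ne'
  · intro s hs
    have hs1 : 1 < s := hs.1
    have hs0 : 0 < s := by linarith
    have key : 0 ≤ Real.exp (s / 2) * (s - 4) + 3 * Real.exp 2 * s ^ 2 := by
      rcases le_total 4 s with h4 | h4
      · have : 0 ≤ s - 4 := by linarith
        positivity
      · have h1 : Real.exp (s / 2) ≤ Real.exp 2 := Real.exp_le_exp.mpr (by linarith)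
        have h2 : 0 < Real.exp (s / 2) := Real.exp_pos _
        have h3 : 0 < Real.exp 2 := Real.exp_pos _
        have h5 : Real.exp (s / 2) * (4 - s) ≤ Real.exp 2 * 3 := by
          gcongr; linarith
        have h6 : Real.exp 2 * 1 ≤ Real.exp 2 * s ^ 2 := by
          gcongr
          nlinarith
        linarith
    rw [← sub_nonneg]
    have : (4 * (Real.exp (s / 2) * (1 / 2)) * s - 4 * Real.exp (s / 2) * 1) / s ^ 2
        + 3 * Real.exp 2 * 1 - Real.exp (s / 2) * s⁻¹
        = (Real.exp (s / 2) * (s - 4) + 3 * Real.exp 2 * s ^ 2) / s ^ 2 := by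
      field_simp
      ring
    rw [this]
    positivity

lemma tendsto_exp_neg_half_mul_integral :
    Tendsto (fun z : ℝ => Real.exp (-z / 2) * ∫ s in (1 : ℝ)..z, Real.exp (s / 2) * s⁻¹)
      atTop (𝓝 0) := by
  have hlim : Tendsto (fun z : ℝ => 4 * z⁻¹ + 3 * Real.exp 2 * (z ^ 1 * Real.exp (-z / 2)))
      atTop (𝓝 0) := by
    simpa using (tendsto_inv_atTop_zero.const_mul 4).add
      ((tendsto_pow_mul_exp_neg_half 1).const_mul (3 * Real.exp 2))
  refine squeeze_zero' ?_ ?_ hlim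
  · filter_upwards [eventually_ge_atTop 1] with z hz
    refine mul_nonneg (Real.exp_pos _).le (intervalIntegral.integral_nonneg hz fun s hs => ?_)
    have : 0 ≤ s := zero_le_one.trans hs.1
    positivity
  · filter_upwards [eventually_ge_atTop 1] with z hz
    have he : Real.exp (-z / 2) * Real.exp (z / 2) = 1 := by
      rw [← Real.exp_add, ← add_div]; simp
    calc _ ≤ Real.exp (-z / 2) * (4 * Real.exp (z / 2) / z + 3 * Real.exp 2 * z) := by
          gcongr
          exact integral_exp_half_div_le hz
      _ = (Real.exp (-z / 2) * Real.exp (z / 2)) * (4 * z⁻¹)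
          + 3 * Real.exp 2 * (z ^ 1 * Real.exp (-z / 2)) := by ring
      _ = _ := by rw [he, one_mul]

/-- The particular solution in the variable `z`, with constants left by the change of variable. -/
def particular (a : ℝ) (g : ℝ → ℝ) (A B c K z₀ z : ℝ) : ℝ :=
  A * (growing a z * ∫ s in Ioi z, decaying a s * g s / s)
    + B * (decaying a z * (c + K * ∫ s in z₀..z, growing a s * g s / s))

lemma tendsto_particular (ha : 0 < a) (hg : Continuous g) {G : ℝ} (hG : ∀ s, |g s| ≤ G)
    (A B c K : ℝ) {z₀ : ℝ} (hz₀ : 0 < z₀) :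
    Tendsto (particular a g A B c K z₀) atTop (𝓝 0) := by
  obtain ⟨C, _, hC⟩ := exists_growing_mul_integral_le ha
  obtain ⟨D, E, hDE⟩ := exists_decaying_mul_integral_le (b := fun s => G * s⁻¹) ha hg
    (continuousOn_const.mul (continuousOn_id.inv₀ fun s hs => (zero_lt_one.trans_le hs).ne'))
    (fun s hs => by
      rw [div_eq_mul_inv]
      have := hG s
      gcongr) c K hz₀
  have h1 : Tendsto (fun z => growing a z * ∫ s in Ioi z, decaying a s * g s / s)
      atTop (𝓝 0) := by
    refine squeeze_zero_norm' ?_ (tendsto_const_nhds (x := C * G)|>.div_atTop tendsto_id)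
    filter_upwards [eventually_ge_atTop 1] with z hz
    exact hC g G z hz fun s _ => hG s
  have h2 : Tendsto (fun z => decaying a z * (c + K * ∫ s in z₀..z, growing a s * g s / s))
      atTop (𝓝 0) := by
    have hlim : Tendsto (fun z : ℝ => D * (z ^ 0 * Real.exp (-z / 2)) + E * G *
        (Real.exp (-z / 2) * ∫ s in (1 : ℝ)..z, Real.exp (s / 2) * s⁻¹)) atTop (𝓝 0) := by
      simpa using ((tendsto_pow_mul_exp_neg_half 0).const_mul D).add
        (tendsto_exp_neg_half_mul_integral.const_mul (E * G))
    refine squeeze_zero_norm' ?_ hlim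
    filter_upwards [eventually_ge_atTop 1] with z hz
    refine (hDE z hz).trans (le_of_eq ?_)
    simp only [mul_left_comm _ G, intervalIntegral.integral_const_mul]
    ring
  have h := (h1.const_mul A).add (h2.const_mul B)
  rw [mul_zero, mul_zero, add_zero] at h
  exact h

lemma particular_isBigO (ha : 0 < a) (hg : Continuous g) {G : ℝ}
    (hG : ∀ s ≥ 1, |g s| ≤ G * Real.exp (-s / 2)) (A B c K : ℝ) {z₀ : ℝ} (hz₀ : 0 < z₀) :
    particular a g A B c K z₀ =O[atTop] fun z => 1 / z ^ 2 := by
  have hG0 : 0 ≤ G := nonneg_of_mul_nonneg_left ((abs_nonneg _).trans (hG 1 le_rfl))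
    (Real.exp_pos _)
  obtain ⟨C, hC0, hC⟩ := exists_growing_mul_integral_le ha
  obtain ⟨D, E, hDE⟩ := exists_decaying_mul_integral_le (b := fun s => G * Real.exp (-s / 2)) ha hg
    (by fun_prop)
    (fun s hs => (div_le_self (abs_nonneg _) hs).trans (hG s hs)) c K hz₀
  have h1 : (fun z => growing a z * ∫ s in Ioi z, decaying a s * g s / s)
      =O[atTop] fun z => 1 / z ^ 2 := by
    refine IsBigO.trans (IsBigO.of_bound (C * G) ?_) (exp_neg_half_isBigO 0)
    filter_upwards [eventually_ge_atTop 1] with z hz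
    have := hC g (G * Real.exp (-z / 2)) z hz fun s hs => by
      refine (hG s (hz.trans hs.le)).trans ?_
      gcongr
    refine this.trans ((div_le_self (by positivity) hz).trans (le_of_eq ?_))
    rw [pow_zero, one_mul, Real.norm_of_nonneg (Real.exp_pos _).le]
    ring
  have h2 : (fun z => decaying a z * (c + K * ∫ s in z₀..z, growing a s * g s / s))
      =O[atTop] fun z => 1 / z ^ 2 := by
    -- With this majorant the integrand `e^{s/2} b s` is the constant `G`, so the integral is `G (z
    -- - 1)`.
    have hlim : (fun z : ℝ => (D - E * G) * (z ^ 0 * Real.exp (-z / 2))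
        + E * G * (z ^ 1 * Real.exp (-z / 2))) =O[atTop] fun z => 1 / z ^ 2 :=
      ((exp_neg_half_isBigO 0).const_mul_left _).add ((exp_neg_half_isBigO 1).const_mul_left _)
    refine IsBigO.trans (IsBigO.of_bound 1 ?_) hlim
    filter_upwards [eventually_ge_atTop 1] with z hz
    have he : ∀ s : ℝ, Real.exp (s / 2) * (G * Real.exp (-s / 2)) = G := fun s => by
      rw [mul_left_comm, ← Real.exp_add, ← add_div]; simp
    have h := hDE z hz
    simp only [he, intervalIntegral.integral_const, smul_eq_mul] at h
    rw [one_mul]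
    refine h.trans (le_trans (le_of_eq ?_) (le_abs_self _))
    ring
  exact (h1.const_mul_left A).add (h2.const_mul_left B)

end Core

/-! ### Change of variable from `X` to `z` -/

namespace Piece

variable (P : Piece)

/-- The constant factor `e^{kμ}` relating `y₁`, `y₂` to functions of `z`. -/
def scale : ℝ := Real.exp (P.k * P.μ)

/-- The constant in `y f / ((b₂ + a₂ X) W) = const · (solution in z) f / z`. -/
def integrandScale : ℝ := P.scale / (P.scale ^ 2 * P.a₂ * kummerWronskian P.a 1)

lemma exp_k_mul (X : ℝ) : Real.exp (P.k * X) = P.scale * Real.exp (-P.z X / 2) := by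
  rw [scale, z, ← Real.exp_add]
  ring_nf

lemma y₁_eq (X : ℝ) : P.y₁ X = P.scale * decaying P.a (P.z X) := by
  rw [y₁, exp_k_mul, decaying]; ring

lemma y₂_eq (X : ℝ) : P.y₂ X = P.scale * growing P.a (P.z X) := by
  rw [y₂, exp_k_mul, growing]; ring

lemma hasDerivAt_z (X : ℝ) : HasDerivAt P.z (-(2 * P.k)) X := by
  refine (((hasDerivAt_id X).const_sub P.μ).const_mul (2 * P.k)).congr_deriv ?_
  ring

variable {P}

lemma W_eq (ha : 0 < P.a) {X : ℝ} (hz : 0 < P.z X) :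
    P.W X = P.scale ^ 2 * (-(2 * P.k)) * kummerWronskian P.a 1 := by
  have h1 : HasDerivAt P.y₁ _ X :=
    (((hasDerivAt_decaying ha hz).differentiableAt.hasDerivAt.comp X
      (P.hasDerivAt_z X)).const_mul P.scale).congr_of_eventuallyEq
      (Eventually.of_forall P.y₁_eq)
  have h2 : HasDerivAt P.y₂ _ X :=
    (((hasDerivAt_growing ha (P.z X)).differentiableAt.hasDerivAt.comp X
      (P.hasDerivAt_z X)).const_mul P.scale).congr_of_eventuallyEq
      (Eventually.of_forall P.y₂_eq)
  rw [W, h1.deriv, h2.deriv, y₁_eq, y₂_eq, ← wronskian_decaying_growing ha hz]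
  ring

/-- The factor `-2k` that the chain rule puts into `W` turns `b₂ + a₂ X = -a₂ (μ - X)` into `a₂ z`,
whatever the sign of `k`. -/
lemma coeff_mul_W (ha₂ : P.a₂ ≠ 0) (ha : 0 < P.a) {X : ℝ}
    (hz : 0 < P.z X) :
    (P.b₂ + P.a₂ * X) * P.W X = P.scale ^ 2 * P.a₂ * kummerWronskian P.a 1 * P.z X := by
  have h : P.b₂ + P.a₂ * X = -(P.a₂ * (P.μ - X)) := by
    rw [μ]
    field_simp
    ring
  rw [W_eq ha hz, h, z]
  ring

lemma integrand₁_eq (ha₂ : P.a₂ ≠ 0) (ha : 0 < P.a) (f : ℝ → ℝ) {X : ℝ}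
    (hz : 0 < P.z X) :
    P.integrand₁ f X = P.integrandScale * (decaying P.a (P.z X) * f X / P.z X) := by
  rw [integrand₁, coeff_mul_W ha₂ ha hz, y₁_eq, integrandScale, div_mul_div_comm]
  ring

lemma integrand₂_eq (ha₂ : P.a₂ ≠ 0) (ha : 0 < P.a) (f : ℝ → ℝ) {X : ℝ}
    (hz : 0 < P.z X) :
    P.integrand₂ f X = P.integrandScale * (growing P.a (P.z X) * f X / P.z X) := by
  rw [integrand₂, coeff_mul_W ha₂ ha hz, y₂_eq, integrandScale, div_mul_div_comm]
  ring

lemma intervalIntegrable_integrand₂ (ha₂ : P.a₂ ≠ 0) (ha : 0 < P.a)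
    {f : ℝ → ℝ} (hf : Continuous f) {x y : ℝ} (h : ∀ t ∈ uIcc x y, 0 < P.z t) :
    IntervalIntegrable (P.integrand₂ f) volume x y := by
  have hzc : Continuous P.z :=
    continuous_iff_continuousAt.mpr fun X => (P.hasDerivAt_z X).continuousAt
  refine ContinuousOn.intervalIntegrable (ContinuousOn.congr
    (f := fun X => P.integrandScale * (growing P.a (P.z X) * f X / P.z X)) ?_
    fun X hX => integrand₂_eq ha₂ ha f (h X hX))
  refine ContinuousOn.mul continuousOn_const (ContinuousOn.div ?_ hzc.continuousOn
    fun t ht => (h t ht).ne')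
  exact (((continuous_growing ha).comp hzc).mul hf).continuousOn

lemma z_left (hk : P.k = 1 / 2) (X : ℝ) : P.z X = P.μ - X := by rw [z, hk]; ring

lemma z_right (hk : P.k = -1 / 2) (X : ℝ) : P.z X = X - P.μ := by rw [z, hk]; ring

lemma integrand₁_left (ha₂ : P.a₂ ≠ 0) (ha : 0 < P.a) (hk : P.k = 1 / 2) (f : ℝ → ℝ) {x : ℝ}
    (hx : x < P.μ) :
    P.integrand₁ f x = P.integrandScale *
      (decaying P.a (P.μ - x) * f (P.μ - (P.μ - x)) / (P.μ - x)) := by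
  rw [integrand₁_eq ha₂ ha f (by rw [z_left hk]; linarith), z_left hk, sub_sub_cancel]

lemma integrand₂_left (ha₂ : P.a₂ ≠ 0) (ha : 0 < P.a) (hk : P.k = 1 / 2) (f : ℝ → ℝ) {x : ℝ}
    (hx : x < P.μ) :
    P.integrand₂ f x = P.integrandScale *
      (growing P.a (P.μ - x) * f (P.μ - (P.μ - x)) / (P.μ - x)) := by
  rw [integrand₂_eq ha₂ ha f (by rw [z_left hk]; linarith), z_left hk, sub_sub_cancel]

lemma integrand₁_right (ha₂ : P.a₂ ≠ 0) (ha : 0 < P.a) (hk : P.k = -1 / 2) (f : ℝ → ℝ) {x : ℝ}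
    (hx : P.μ < x) :
    P.integrand₁ f x = P.integrandScale *
      (decaying P.a (x - P.μ) * f (P.μ + (x - P.μ)) / (x - P.μ)) := by
  rw [integrand₁_eq ha₂ ha f (by rw [z_right hk]; linarith), z_right hk, add_sub_cancel]

lemma integrand₂_right (ha₂ : P.a₂ ≠ 0) (ha : 0 < P.a) (hk : P.k = -1 / 2) (f : ℝ → ℝ) {x : ℝ}
    (hx : P.μ < x) :
    P.integrand₂ f x = P.integrandScale *
      (growing P.a (x - P.μ) * f (P.μ + (x - P.μ)) / (x - P.μ)) := by
  rw [integrand₂_eq ha₂ ha f (by rw [z_right hk]; linarith), z_right hk, add_sub_cancel]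

lemma integrableOn_integrand₁_left (ha₂ : P.a₂ ≠ 0) (ha : 0 < P.a) (hk : P.k = 1 / 2)
    {f : ℝ → ℝ} (hf : Continuous f) {G : ℝ} (hG : ∀ s, |f s| ≤ G) {X : ℝ} (hX : X < P.μ) :
    IntegrableOn (P.integrand₁ f) (Iic X) := by
  have h := integrableOn_decaying ha (g := fun s => f (P.μ - s)) (by fun_prop) (sub_pos.mpr hX)
    fun s _ => hG _
  -- The reflection `x ↦ μ - x` carries `Iic X` to a closed half-line, hence the passage from `Ioi`
  -- to `Ici`.
  rw [← integrableOn_Ici_iff_integrableOn_Ioi, ← (Measure.measurePreserving_sub_left volume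
    P.μ).integrableOn_comp_preimage (MeasurableEquiv.subLeft P.μ).measurableEmbedding] at h
  simp only [preimage_const_sub_Ici, sub_sub_cancel] at h
  exact IntegrableOn.congr_fun (h.const_mul P.integrandScale)
    (fun x hx => (integrand₁_left ha₂ ha hk f (lt_of_le_of_lt hx hX)).symm) measurableSet_Iic

lemma integrableOn_integrand₁_right (ha₂ : P.a₂ ≠ 0) (ha : 0 < P.a) (hk : P.k = -1 / 2)
    {f : ℝ → ℝ} (hf : Continuous f) {G : ℝ} (hG : ∀ s, |f s| ≤ G) {X : ℝ} (hX : P.μ < X) :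
    IntegrableOn (P.integrand₁ f) (Ioi X) := by
  have h := integrableOn_decaying ha (g := fun s => f (P.μ + s)) (by fun_prop) (sub_pos.mpr hX)
    fun s _ => hG _
  rw [← (measurePreserving_sub_right volume
    P.μ).integrableOn_comp_preimage (MeasurableEquiv.subRight P.μ).measurableEmbedding] at h
  simp only [preimage_sub_const_Ioi, sub_add_cancel] at h
  exact IntegrableOn.congr_fun (h.const_mul P.integrandScale)
    (fun x hx => (integrand₁_right ha₂ ha hk f (lt_trans hX hx)).symm) measurableSet_Ioi

/-- The reflection reverses the oriented integral from `ξ` to `X`, hence `-P.integrandScale` there,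
while the tail integral keeps its sign. -/
lemma I₁₂Left_eq (ha₂ : P.a₂ ≠ 0) (ha : 0 < P.a) (hk : P.k = 1 / 2) (f : ℝ → ℝ) (c : ℝ)
    {ξ X : ℝ} (hξ : ξ < P.μ) (hX : X < P.μ) :
    P.I₁₂Left f ξ c X = particular P.a (fun s => f (P.μ - s)) (P.scale * P.integrandScale)
      (-P.scale) c (-P.integrandScale) (P.z ξ) (P.z X) := by
  have h1 : ∫ x in Iic X, P.integrand₁ f x = P.integrandScale *
      ∫ s in Ioi (P.z X), decaying P.a s * f (P.μ - s) / s := by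
    have e := (Measure.measurePreserving_sub_left volume P.μ).setIntegral_preimage_emb
      (MeasurableEquiv.subLeft P.μ).measurableEmbedding
      (fun s => decaying P.a s * f (P.μ - s) / s) (Ici (P.μ - X))
    rw [preimage_const_sub_Ici, sub_sub_cancel] at e
    rw [setIntegral_congr_fun measurableSet_Iic
      fun x hx => integrand₁_left ha₂ ha hk f (lt_of_le_of_lt hx hX), integral_const_mul,
      z_left hk, ← integral_Ici_eq_integral_Ioi, e]
  have h2 : ∫ x in ξ..X, P.integrand₂ f x = -P.integrandScale *
      ∫ s in P.z ξ..P.z X, growing P.a s * f (P.μ - s) / s := by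
    rw [intervalIntegral.integral_congr
      fun x hx => integrand₂_left ha₂ ha hk f (lt_of_le_of_lt hx.2 (max_lt hξ hX)),
      intervalIntegral.integral_const_mul,
      intervalIntegral.integral_comp_sub_left (fun s => growing P.a s * f (P.μ - s) / s),
      intervalIntegral.integral_symm, z_left hk, z_left hk]
    ring
  rw [I₁₂Left, h1, h2, y₁_eq, y₂_eq, particular]
  ring

/-- A translation preserves orientation; the minus sign in the first coefficient comes from
`∫_{+∞}^X = -∫_X^{+∞}`. -/
lemma I₁₂Right_eq (ha₂ : P.a₂ ≠ 0) (ha : 0 < P.a) (hk : P.k = -1 / 2) (f : ℝ → ℝ) (c : ℝ)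
    {ξ X : ℝ} (hξ : P.μ < ξ) (hX : P.μ < X) :
    P.I₁₂Right f ξ c X = particular P.a (fun s => f (P.μ + s)) (-(P.scale * P.integrandScale))
      (-P.scale) c P.integrandScale (P.z ξ) (P.z X) := by
  have h1 : ∫ x in Ioi X, P.integrand₁ f x = P.integrandScale *
      ∫ s in Ioi (P.z X), decaying P.a s * f (P.μ + s) / s := by
    have e := (measurePreserving_sub_right volume P.μ).setIntegral_preimage_emb
      (MeasurableEquiv.subRight P.μ).measurableEmbedding
      (fun s => decaying P.a s * f (P.μ + s) / s) (Ioi (X - P.μ))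
    rw [preimage_sub_const_Ioi, sub_add_cancel] at e
    rw [setIntegral_congr_fun measurableSet_Ioi
      fun x hx => integrand₁_right ha₂ ha hk f (lt_trans hX hx), integral_const_mul,
      z_right hk, e]
  have h2 : ∫ x in ξ..X, P.integrand₂ f x = P.integrandScale *
      ∫ s in P.z ξ..P.z X, growing P.a s * f (P.μ + s) / s := by
    rw [intervalIntegral.integral_congr
      fun x hx => integrand₂_right ha₂ ha hk f (lt_of_lt_of_le (lt_min hξ hX) hx.1),
      intervalIntegral.integral_const_mul,
      intervalIntegral.integral_comp_sub_right (fun s => growing P.a s * f (P.μ + s) / s),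
      z_right hk, z_right hk]
  rw [I₁₂Right, h1, h2, y₁_eq, y₂_eq, particular]
  ring

lemma tendsto_z_left (hk : P.k = 1 / 2) : Tendsto P.z atBot atTop := by
  rw [show P.z = fun X => P.μ + -X from funext fun X => by rw [z_left hk, sub_eq_add_neg]]
  exact tendsto_atTop_add_const_left _ _ tendsto_neg_atBot_atTop

lemma tendsto_z_right (hk : P.k = -1 / 2) : Tendsto P.z atTop atTop := by
  rw [show P.z = fun X => X + -P.μ from funext fun X => by rw [z_right hk, sub_eq_add_neg]]
  exact tendsto_atTop_add_const_right _ _ tendsto_id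

lemma tendsto_I₁₂Left (ha₂ : P.a₂ ≠ 0) (ha : 0 < P.a) (hk : P.k = 1 / 2) {f : ℝ → ℝ}
    (hf : Continuous f) {G : ℝ} (hG : ∀ s, |f s| ≤ G) {ξ : ℝ} (hξ : ξ < P.μ) (c : ℝ) :
    Tendsto (P.I₁₂Left f ξ c) atBot (𝓝 0) := by
  refine ((tendsto_particular ha (g := fun s => f (P.μ - s)) (by fun_prop) (fun s => hG _)
    (P.scale * P.integrandScale) (-P.scale) c (-P.integrandScale) (z₀ := P.z ξ)
    (by rw [z_left hk]; linarith)).comp (tendsto_z_left hk)).congr' ?_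
  filter_upwards [eventually_lt_atBot P.μ] with X hX
  exact (I₁₂Left_eq ha₂ ha hk f c hξ hX).symm

lemma tendsto_I₁₂Right (ha₂ : P.a₂ ≠ 0) (ha : 0 < P.a) (hk : P.k = -1 / 2) {f : ℝ → ℝ}
    (hf : Continuous f) {G : ℝ} (hG : ∀ s, |f s| ≤ G) {ξ : ℝ} (hξ : P.μ < ξ) (c : ℝ) :
    Tendsto (P.I₁₂Right f ξ c) atTop (𝓝 0) := by
  refine ((tendsto_particular ha (g := fun s => f (P.μ + s)) (by fun_prop) (fun s => hG _)
    (-(P.scale * P.integrandScale)) (-P.scale) c P.integrandScale (z₀ := P.z ξ)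
    (by rw [z_right hk]; linarith)).comp (tendsto_z_right hk)).congr' ?_
  filter_upwards [eventually_gt_atTop P.μ] with X hX
  exact (I₁₂Right_eq ha₂ ha hk f c hξ hX).symm

lemma I₁₂Left_isBigO (ha₂ : P.a₂ ≠ 0) (ha : 0 < P.a) (hk : P.k = 1 / 2) {f : ℝ → ℝ}
    (hf : Continuous f) {G : ℝ} (hG : ∀ s ≥ 1, |f (P.μ - s)| ≤ G * Real.exp (-s / 2)) {ξ : ℝ}
    (hξ : ξ < P.μ) (c : ℝ) :
    P.I₁₂Left f ξ c =O[atBot] fun X => 1 / P.z X ^ 2 := by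
  refine IsBigO.congr' ((particular_isBigO ha (g := fun s => f (P.μ - s)) (by fun_prop) hG
    (P.scale * P.integrandScale) (-P.scale) c (-P.integrandScale)
    (z₀ := P.z ξ) (by rw [z_left hk]; linarith)).comp_tendsto (tendsto_z_left hk)) ?_ .rfl
  filter_upwards [eventually_lt_atBot P.μ] with X hX
  exact (I₁₂Left_eq ha₂ ha hk f c hξ hX).symm

lemma I₁₂Right_isBigO (ha₂ : P.a₂ ≠ 0) (ha : 0 < P.a) (hk : P.k = -1 / 2) {f : ℝ → ℝ}
    (hf : Continuous f) {G : ℝ} (hG : ∀ s ≥ 1, |f (P.μ + s)| ≤ G * Real.exp (-s / 2)) {ξ : ℝ}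
    (hξ : P.μ < ξ) (c : ℝ) :
    P.I₁₂Right f ξ c =O[atTop] fun X => 1 / P.z X ^ 2 := by
  refine IsBigO.congr' ((particular_isBigO ha (g := fun s => f (P.μ + s)) (by fun_prop) hG
    (-(P.scale * P.integrandScale)) (-P.scale) c P.integrandScale
    (z₀ := P.z ξ) (by rw [z_right hk]; linarith)).comp_tendsto (tendsto_z_right hk)) ?_ .rfl
  filter_upwards [eventually_gt_atTop P.μ] with X hX
  exact (I₁₂Right_eq ha₂ ha hk f c hξ hX).symm

end Piece

/-! ### Sources: the payoff and continuous functions vanishing at infinity -/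

lemma payoff_eq (X : ℝ) : payoff X = Real.exp (-|X| / 2) := by
  unfold payoff
  split_ifs with h
  · rw [abs_of_pos h]
  · rw [abs_of_nonpos (not_lt.mp h), neg_neg]

lemma continuous_payoff : Continuous payoff := by
  rw [show payoff = _ from funext payoff_eq]
  fun_prop

lemma abs_payoff_le_one (X : ℝ) : |payoff X| ≤ 1 := by
  rw [payoff_eq, abs_of_pos (Real.exp_pos _), Real.exp_le_one_iff]
  have := abs_nonneg X
  linarith

/-- Here `s` is the value of `z` at `X`; the shift by `μ` between the two costs only the factor
`e^{m/2}`. -/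
lemma abs_payoff_le {m s X : ℝ} (h : s ≤ m + |X|) :
    |payoff X| ≤ Real.exp (m / 2) * Real.exp (-s / 2) := by
  rw [payoff_eq, abs_of_pos (Real.exp_pos _), ← Real.exp_add, Real.exp_le_exp]
  linarith

/-- The limits of the source at infinity enter only through this bound. -/
lemma exists_abs_le_of_tendsto_zero {f : ℝ → ℝ} (hf : Continuous f) (hb : Tendsto f atBot (𝓝 0))
    (ht : Tendsto f atTop (𝓝 0)) : ∃ G, ∀ s, |f s| ≤ G := by
  let F : ZeroAtInftyContinuousMap ℝ ℝ :=
    ⟨⟨f, hf⟩, by rw [cocompact_eq_atBot_atTop]; exact hb.sup ht⟩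
  exact ⟨‖F.toBCF‖, fun s => F.toBCF.norm_coe_le_norm s⟩

end LocalVariance

end

theorem proposition2
    (p : ℝ) (hp : 0 < p)
    (v₀ v₁ Xl : ℝ) (hv₁ : v₁ < 0) (hv : ∀ X ≤ Xl, 0 ≤ v₀ + v₁ * X)
    (w₀ w₁ Xr : ℝ) (hw₁ : 0 < w₁) (hw : ∀ X ≥ Xr, 0 ≤ w₀ + w₁ * X)
    (L R : LocalVariance.Piece)
    (hL : L = { p := p, v₀ := v₀, v₁ := v₁, k := 1 / 2 })
    (hR : R = { p := p, v₀ := w₀, v₁ := w₁, k := -1 / 2 })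
    (ξl cl ξr cr : ℝ) (hξl : ξl < Xl) (hξr : Xr < ξr) :
    -- first time step
    (Tendsto (L.I₁₂Left LocalVariance.payoff ξl cl) atBot (𝓝 0) ∧
      Tendsto (R.I₁₂Right LocalVariance.payoff ξr cr) atTop (𝓝 0) ∧
      (L.I₁₂Left LocalVariance.payoff ξl cl =O[atBot] fun X => 1 / L.z X ^ 2) ∧
      (R.I₁₂Right LocalVariance.payoff ξr cr =O[atTop] fun X => 1 / R.z X ^ 2)) ∧
    -- any time step
    (∀ f : ℝ → ℝ, Continuous f → Tendsto f atBot (𝓝 0) → Tendsto f atTop (𝓝 0) →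
      (∀ X < Xl, IntegrableOn (L.integrand₁ f) (Iic X) ∧
        IntervalIntegrable (L.integrand₂ f) volume ξl X) ∧
      (∀ X > Xr, IntegrableOn (R.integrand₁ f) (Ioi X) ∧
        IntervalIntegrable (R.integrand₂ f) volume ξr X) ∧
      Tendsto (L.I₁₂Left f ξl cl) atBot (𝓝 0) ∧
      Tendsto (R.I₁₂Right f ξr cr) atTop (𝓝 0)) := by
  have hkL : L.k = 1 / 2 := by rw [hL]
  have hkR : R.k = -1 / 2 := by rw [hR]
  have ha₂L : L.a₂ ≠ 0 := by
    simp only [hL, LocalVariance.Piece.a₂]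
    exact div_ne_zero (neg_ne_zero.mpr hv₁.ne) two_ne_zero
  have ha₂R : R.a₂ ≠ 0 := by
    simp only [hR, LocalVariance.Piece.a₂]
    exact div_ne_zero (neg_ne_zero.mpr hw₁.ne') two_ne_zero
  have haL : 0 < L.a := by
    -- As `k² = 1/4`, the terms in `v₀` cancel and `b₂ k² + b₀ = p`.
    have h : L.a = 2 * p / -v₁ := by
      simp only [hL, LocalVariance.Piece.a, LocalVariance.Piece.a₂, LocalVariance.Piece.b₂,
        LocalVariance.Piece.b₀]
      have := hv₁.ne
      field_simp
      ring
    rw [h]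
    exact div_pos (by linarith) (by linarith)
  have haR : 0 < R.a := by
    have h : R.a = 2 * p / w₁ := by
      simp only [hR, LocalVariance.Piece.a, LocalVariance.Piece.a₂, LocalVariance.Piece.b₂,
        LocalVariance.Piece.b₀]
      have := hw₁.ne'
      field_simp
      ring
    rw [h]
    exact div_pos (by linarith) hw₁
  -- `μ` is the zero of the linear variance, so nonnegativity at `Xl` places it at or beyond the
  -- endpoint, and `z > 0` for `X < Xl`.
  have hμL : Xl ≤ L.μ := by
    have h : L.μ = v₀ / -v₁ := by
      simp only [hL, LocalVariance.Piece.μ, LocalVariance.Piece.a₂, LocalVariance.Piece.b₂]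
      have := hv₁.ne
      field_simp
    rw [h, le_div_iff₀ (by linarith)]
    linarith [hv Xl le_rfl]
  have hμR : R.μ ≤ Xr := by
    have h : R.μ = -w₀ / w₁ := by
      simp only [hR, LocalVariance.Piece.μ, LocalVariance.Piece.a₂, LocalVariance.Piece.b₂]
      have := hw₁.ne'
      field_simp
    rw [h, div_le_iff₀ hw₁]
    linarith [hw Xr le_rfl]
  have hξL : ξl < L.μ := hξl.trans_le hμL
  have hξR : R.μ < ξr := hμR.trans_lt hξr
  refine ⟨⟨?_, ?_, ?_, ?_⟩, fun f hf hb ht => ?_⟩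
  · exact LocalVariance.Piece.tendsto_I₁₂Left ha₂L haL hkL LocalVariance.continuous_payoff
      LocalVariance.abs_payoff_le_one hξL cl
  · exact LocalVariance.Piece.tendsto_I₁₂Right ha₂R haR hkR LocalVariance.continuous_payoff
      LocalVariance.abs_payoff_le_one hξR cr
  · refine LocalVariance.Piece.I₁₂Left_isBigO ha₂L haL hkL LocalVariance.continuous_payoff
      (fun s _ => LocalVariance.abs_payoff_le (m := L.μ) ?_) hξL cl
    linarith [neg_le_abs (L.μ - s)]
  · refine LocalVariance.Piece.I₁₂Right_isBigO ha₂R haR hkR LocalVariance.continuous_payoff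
      (fun s _ => LocalVariance.abs_payoff_le (m := -R.μ) ?_) hξR cr
    linarith [le_abs_self (R.μ + s)]
  · obtain ⟨G, hG⟩ := LocalVariance.exists_abs_le_of_tendsto_zero hf hb ht
    refine ⟨fun X hX => ⟨?_, ?_⟩, fun X hX => ⟨?_, ?_⟩, ?_, ?_⟩
    · exact LocalVariance.Piece.integrableOn_integrand₁_left ha₂L haL hkL hf hG
        (hX.trans_le hμL)
    · refine LocalVariance.Piece.intervalIntegrable_integrand₂ ha₂L haL hf fun t ht => ?_
      rw [LocalVariance.Piece.z_left hkL, sub_pos]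
      exact ht.2.trans_lt (max_lt hξL (hX.trans_le hμL))
    · exact LocalVariance.Piece.integrableOn_integrand₁_right ha₂R haR hkR hf hG
        (hμR.trans_lt hX)
    · refine LocalVariance.Piece.intervalIntegrable_integrand₂ ha₂R haR hf fun t ht => ?_
      rw [LocalVariance.Piece.z_right hkR, sub_pos]
      exact (lt_min hξR (hμR.trans_lt hX)).trans_le ht.1
    · exact LocalVariance.Piece.tendsto_I₁₂Left ha₂L haL hkL hf hG hξL cl
    · exact LocalVariance.Piece.tendsto_I₁₂Right ha₂R haR hkR hf hG hξR cr
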